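/- Let $M^n\subset\mathbb{R}^{n+1}$ ($n\ge 1$) be a smooth embedded hypersurface with the induced Riemannian metric and let $v\in\mathbb{R}^{n+1}\setminus\{0\}$. Let $$S\partial(M,v)=\{x\in M \mid v\in T_xM\}$$ be the shadow boundary of $M$ with respect to the constant vector field $v$. Let $L\subset S\partial(M,v)$ be a compact smooth embedded submanifold (without boundary) of $M$ of codimension one, and assume that $L$ is contained in an affine hyperplane $\Pi\subset\mathbb{R}^{n+1}$ which is transverse to $v$ (that is, $v$ does not lie in the direction space of $\Pi$). If $L$ is a minimal submanifold of $M$, i.e. the mean curvature vector field of $L$ in $M$ vanishes identically, then $L$ is a totally geodesic submanifold of $M$, i.e. every geodesic of $L$ is a geodesic of $M$. -/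

import Mathlib

open Set Topology
open scoped ContDiff

noncomputable section

namespace EuclideanSubmanifold

variable {E : Type*} [NormedAddCommGroup E] [InnerProductSpace ℝ E]

/-- `Φ` is a slice chart of `S`: a smooth diffeomorphism between open subsets of `E` which
straightens `S` to the linear subspace `V`. -/
structure IsSliceChart (S : Set E) (V : Submodule ℝ E) (Φ : OpenPartialHomeomorph E E) : Prop where
  smooth : ContDiffOn ℝ ∞ Φ Φ.source
  smooth_symm : ContDiffOn ℝ ∞ Φ.symm Φ.target
  mem_iff : ∀ x ∈ Φ.source, (x ∈ S ↔ Φ x ∈ V)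

/-- `S` is an embedded smooth (`C^∞`) submanifold, without boundary, of dimension `d` of `E`.
When `M` is such a submanifold of `E` and `L ⊆ M`, then `L` is an embedded submanifold of `M` if
and only if it is an embedded submanifold of `E`. -/
def IsSmoothSubmanifold (d : ℕ) (S : Set E) : Prop :=
  ∀ p ∈ S, ∃ (V : Submodule ℝ E) (Φ : OpenPartialHomeomorph E E),
    Module.finrank ℝ V = d ∧ IsSliceChart S V Φ ∧ p ∈ Φ.source

/-- The velocities at `p` of the smooth curves that lie in `S` and pass through `p` at time `0`. -/
def velocities (S : Set E) (p : E) : Set E :=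
  {w | ∃ (ε : ℝ) (γ : ℝ → E), 0 < ε ∧ ContDiffOn ℝ ∞ γ (Ioo (-ε) ε) ∧
    MapsTo γ (Ioo (-ε) ε) S ∧ γ 0 = p ∧ deriv γ 0 = w}

/-- The tangent space `T_p S`, as a linear subspace of `E`. For a submanifold `S` the set of
velocities is itself a linear subspace, see `coe_tangentSpace`, so that taking the span adds
nothing. -/
def tangentSpace (S : Set E) (p : E) : Submodule ℝ E :=
  Submodule.span ℝ (velocities S p)

/-- The shadow boundary `S∂(M, Y)` of `M` with respect to a vector field `Y`: the set of points of
`M` at which `Y` is tangent to `M`. -/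
def shadowBoundary (M : Set E) (Y : E → E) : Set E :=
  {x | x ∈ M ∧ Y x ∈ tangentSpace M x}

/-- `Z` restricts to a smooth tangent vector field of `S` on a neighbourhood of `p` in `S`. -/
def IsTangentFieldAt (S : Set E) (p : E) (Z : E → E) : Prop :=
  ∃ U : Set E, IsOpen U ∧ p ∈ U ∧ ContDiffOn ℝ ∞ Z U ∧ ∀ x ∈ S ∩ U, Z x ∈ tangentSpace S x

variable [FiniteDimensional ℝ E]

theorem mem_of_hasDerivAt_of_eventually_mem (V : Submodule ℝ E) {f : ℝ → E} {w : E} {t : ℝ}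
    (hf : HasDerivAt f w t) (hV : ∀ᶠ s in 𝓝 t, f s ∈ V) : w ∈ V := by
  have h1 : HasDerivAt (fun s => Vᗮ.starProjection (f s)) (Vᗮ.starProjection w) t :=
    (Vᗮ.starProjection).hasFDerivAt.comp_hasDerivAt t hf
  have h2 : (fun s => Vᗮ.starProjection (f s)) =ᶠ[𝓝 t] fun _ => (0 : E) := by
    filter_upwards [hV] with s hs
    exact (Submodule.starProjection_apply_eq_zero_iff _).2 (by simpa using hs)
  have h3 : Vᗮ.starProjection w = 0 :=
    h1.unique ((hasDerivAt_const t (0 : E)).congr_of_eventuallyEq h2)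
  simpa using (Submodule.starProjection_apply_eq_zero_iff _).1 h3

/-- In a slice chart, the velocities at `p` are the vectors that the chart maps to `V`. -/
theorem velocities_eq {S : Set E} {V : Submodule ℝ E} {Φ : OpenPartialHomeomorph E E} {p : E}
    (hΦ : IsSliceChart S V Φ) (hp : p ∈ S) (hpΦ : p ∈ Φ.source) :
    velocities S p = {w | fderiv ℝ Φ p w ∈ V} := by
  have hd : DifferentiableAt ℝ Φ p :=
    (hΦ.smooth.contDiffAt (Φ.open_source.mem_nhds hpΦ)).differentiableAt (by simp)
  have hds : DifferentiableAt ℝ Φ.symm (Φ p) :=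
    (hΦ.smooth_symm.contDiffAt (Φ.open_target.mem_nhds (Φ.map_source hpΦ))).differentiableAt
      (by simp)
  ext w
  constructor
  · rintro ⟨ε, γ, hε, hγ, hγS, rfl, rfl⟩
    have h0 : Ioo (-ε) ε ∈ 𝓝 (0 : ℝ) := Ioo_mem_nhds (by linarith) hε
    have hγ0 : DifferentiableAt ℝ γ 0 := (hγ.contDiffAt h0).differentiableAt (by simp)
    have h1 : HasDerivAt (fun t => Φ (γ t)) (fderiv ℝ Φ (γ 0) (deriv γ 0)) 0 :=
      hd.hasFDerivAt.comp_hasDerivAt (0 : ℝ) hγ0.hasDerivAt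
    refine mem_of_hasDerivAt_of_eventually_mem V h1 ?_
    filter_upwards [h0, hγ0.continuousAt (Φ.open_source.mem_nhds hpΦ)] with t ht ht'
    exact (hΦ.mem_iff _ ht').1 (hγS ht)
  · intro hw
    set c : ℝ → E := fun t => Φ p + t • fderiv ℝ Φ p w with hc
    have hcs : ContDiff ℝ ∞ c := by fun_prop
    have hc0 : c 0 = Φ p := by simp [hc]
    have hnhds : c ⁻¹' Φ.target ∈ 𝓝 (0 : ℝ) :=
      hcs.continuous.continuousAt (Φ.open_target.mem_nhds (by rw [hc0]; exact Φ.map_source hpΦ))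
    obtain ⟨ε, hε, hball⟩ := Metric.mem_nhds_iff.1 hnhds
    rw [Real.ball_eq_Ioo, zero_sub, zero_add] at hball
    refine ⟨ε, fun t => Φ.symm (c t), hε, hΦ.smooth_symm.comp hcs.contDiffOn hball, ?_, ?_, ?_⟩
    · intro t ht
      refine (hΦ.mem_iff _ (Φ.map_target (hball ht))).2 ?_
      rw [Φ.right_inv (hball ht)]
      exact V.add_mem ((hΦ.mem_iff p hpΦ).1 hp) (V.smul_mem t hw)
    · simp [hc0, Φ.left_inv hpΦ]
    · have hcd : HasDerivAt c (fderiv ℝ Φ p w) 0 := by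
        simpa [hc] using ((hasDerivAt_id (0 : ℝ)).smul_const (fderiv ℝ Φ p w)).const_add (Φ p)
      have h1 : HasDerivAt (fun t => Φ.symm (c t))
          (fderiv ℝ Φ.symm (Φ p) (fderiv ℝ Φ p w)) 0 := by
        refine HasFDerivAt.comp_hasDerivAt (0 : ℝ) ?_ hcd
        rw [hc0]
        exact hds.hasFDerivAt
      have h2 : HasFDerivAt (fun x => Φ.symm (Φ x))
          ((fderiv ℝ Φ.symm (Φ p)).comp (fderiv ℝ Φ p)) p :=
        hds.hasFDerivAt.comp p hd.hasFDerivAt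
      have h3 : (fun x => Φ.symm (Φ x)) =ᶠ[𝓝 p] id := by
        filter_upwards [Φ.open_source.mem_nhds hpΦ] with x hx using Φ.left_inv hx
      have h4 := h2.unique ((hasFDerivAt_id p).congr_of_eventuallyEq h3)
      rw [h1.deriv]
      simpa using DFunLike.congr_fun h4 w

theorem mem_tangentSpace_iff {S : Set E} {V : Submodule ℝ E} {Φ : OpenPartialHomeomorph E E}
    {p : E} (hΦ : IsSliceChart S V Φ) (hp : p ∈ S) (hpΦ : p ∈ Φ.source) {w : E} :
    w ∈ tangentSpace S p ↔ fderiv ℝ Φ p w ∈ V := by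
  have h : velocities S p = (V.comap (fderiv ℝ Φ p : E →ₗ[ℝ] E) : Set E) := by
    rw [velocities_eq hΦ hp hpΦ]
    rfl
  rw [tangentSpace, h, Submodule.span_eq]
  rfl

/-- At a point of a submanifold, the tangent space is the set of all velocities. -/
theorem coe_tangentSpace {d : ℕ} {S : Set E} (hS : IsSmoothSubmanifold d S) {p : E} (hp : p ∈ S) :
    (tangentSpace S p : Set E) = velocities S p := by
  obtain ⟨V, Φ, -, hΦ, hpΦ⟩ := hS p hp
  ext w
  rw [velocities_eq hΦ hp hpΦ]
  exact mem_tangentSpace_iff hΦ hp hpΦ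

/-- Every tangent vector of a submanifold extends to a local smooth tangent vector field. -/
theorem exists_isTangentFieldAt {d : ℕ} {S : Set E} (hS : IsSmoothSubmanifold d S) {p : E}
    (hp : p ∈ S) {w : E} (hw : w ∈ tangentSpace S p) :
    ∃ Z : E → E, IsTangentFieldAt S p Z ∧ Z p = w := by
  obtain ⟨V, Φ, -, hΦ, hpΦ⟩ := hS p hp
  have hinv : ∀ x ∈ Φ.source, ∀ u : E,
      fderiv ℝ Φ x (fderiv ℝ Φ.symm (Φ x) u) = u ∧ fderiv ℝ Φ.symm (Φ x) (fderiv ℝ Φ x u) = u := by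
    intro x hx u
    have hd : DifferentiableAt ℝ Φ x :=
      (hΦ.smooth.contDiffAt (Φ.open_source.mem_nhds hx)).differentiableAt (by simp)
    have hds : DifferentiableAt ℝ Φ.symm (Φ x) :=
      (hΦ.smooth_symm.contDiffAt (Φ.open_target.mem_nhds (Φ.map_source hx))).differentiableAt
        (by simp)
    have hd' : HasFDerivAt Φ (fderiv ℝ Φ x) (Φ.symm (Φ x)) := by
      rw [Φ.left_inv hx]; exact hd.hasFDerivAt
    have h1 : HasFDerivAt (fun y => Φ (Φ.symm y)) _ (Φ x) := hd'.comp (Φ x) hds.hasFDerivAt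
    have h2 : HasFDerivAt (fun y => Φ.symm (Φ y)) _ x := hds.hasFDerivAt.comp x hd.hasFDerivAt
    have e1 : (fun y => Φ (Φ.symm y)) =ᶠ[𝓝 (Φ x)] id := by
      filter_upwards [Φ.open_target.mem_nhds (Φ.map_source hx)] with y hy using Φ.right_inv hy
    have e2 : (fun y => Φ.symm (Φ y)) =ᶠ[𝓝 x] id := by
      filter_upwards [Φ.open_source.mem_nhds hx] with y hy using Φ.left_inv hy
    have h3 := h1.unique ((hasFDerivAt_id (Φ x)).congr_of_eventuallyEq e1)
    have h4 := h2.unique ((hasFDerivAt_id x).congr_of_eventuallyEq e2)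
    exact ⟨by simpa using DFunLike.congr_fun h3 u, by simpa using DFunLike.congr_fun h4 u⟩
  refine ⟨fun x => fderiv ℝ Φ.symm (Φ x) (fderiv ℝ Φ p w),
    ⟨Φ.source, Φ.open_source, hpΦ, ?_, ?_⟩, (hinv p hpΦ w).2⟩
  · have h1 : ContDiffOn ℝ ∞ (fderiv ℝ Φ.symm) Φ.target :=
      hΦ.smooth_symm.fderiv_of_isOpen Φ.open_target (by simp)
    exact (h1.comp hΦ.smooth fun x hx => Φ.map_source hx).clm_apply contDiffOn_const
  · rintro x ⟨hxS, hx⟩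
    rw [mem_tangentSpace_iff hΦ hxS hx, (hinv x hx _).1]
    exact (mem_tangentSpace_iff hΦ hp hpΦ).1 hw

/-- If a tangent vector field vanishes at `p`, its derivatives at `p` in tangent directions are
tangent. -/
theorem fderiv_mem_tangentSpace {d : ℕ} {S : Set E} (hS : IsSmoothSubmanifold d S) {p : E}
    (hp : p ∈ S) {W : E → E} (hW : IsTangentFieldAt S p W) (hW0 : W p = 0) {X : E}
    (hX : X ∈ tangentSpace S p) : fderiv ℝ W p X ∈ tangentSpace S p := by
  have hX' : X ∈ velocities S p := by rw [← coe_tangentSpace hS hp]; exact hX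
  obtain ⟨V, Φ, -, hΦ, hpΦ⟩ := hS p hp
  obtain ⟨U, hU, hpU, hWs, hWt⟩ := hW
  obtain ⟨ε, γ, hε, hγ, hγS, rfl, rfl⟩ := hX'
  have h0 : Ioo (-ε) ε ∈ 𝓝 (0 : ℝ) := Ioo_mem_nhds (by linarith) hε
  have hγ0 : DifferentiableAt ℝ γ 0 := (hγ.contDiffAt h0).differentiableAt (by simp)
  have hWd : DifferentiableAt ℝ W (γ 0) :=
    (hWs.contDiffAt (hU.mem_nhds hpU)).differentiableAt (by simp)
  have hΦd : DifferentiableAt ℝ (fderiv ℝ Φ) (γ 0) :=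
    ((hΦ.smooth.fderiv_of_isOpen (m := ∞) Φ.open_source (by simp)).contDiffAt
      (Φ.open_source.mem_nhds hpΦ)).differentiableAt (by simp)
  have h1 : HasDerivAt (fun t => W (γ t)) (fderiv ℝ W (γ 0) (deriv γ 0)) 0 :=
    hWd.hasFDerivAt.comp_hasDerivAt (0 : ℝ) hγ0.hasDerivAt
  have h2 : HasDerivAt (fun t => fderiv ℝ Φ (γ t)) (fderiv ℝ (fderiv ℝ Φ) (γ 0) (deriv γ 0)) 0 :=
    hΦd.hasFDerivAt.comp_hasDerivAt (0 : ℝ) hγ0.hasDerivAt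
  have h3 := h2.clm_apply h1
  rw [hW0, map_zero, zero_add] at h3
  rw [mem_tangentSpace_iff hΦ hp hpΦ]
  refine mem_of_hasDerivAt_of_eventually_mem V h3 ?_
  filter_upwards [h0, hγ0.continuousAt (Φ.open_source.mem_nhds hpΦ),
    hγ0.continuousAt (hU.mem_nhds hpU)] with t ht ht1 ht2
  exact (mem_tangentSpace_iff hΦ (hγS ht) ht1).1 (hWt _ ⟨hγS ht, ht2⟩)

/-- The Levi-Civita covariant derivative `∇_X Z` at `p` of the submanifold `M` with its induced
metric: the tangential part of the derivative in `E` of the vector field `Z` in the direction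
`X`. -/
def covDeriv (M : Set E) (p : E) (Z : E → E) (X : E) : E :=
  (tangentSpace M p).starProjection (fderiv ℝ Z p X)

open Classical in
/-- The second fundamental form `II_p(X, Y)`, for `X, Y ∈ T_p L`, of the submanifold `L` of the
Riemannian manifold `M ⊆ E`: the part normal to `L` of `∇_X Z`, where `∇` is the
Levi-Civita connection of `M` and `Z` is any local smooth tangent vector field of `L` with
`Z p = Y`. Such fields exist (`exists_isTangentFieldAt`), and the value does not depend on the
choice of one (`secondFundamentalForm_eq`). -/
def secondFundamentalForm (L M : Set E) (p X Y : E) : E :=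
  if h : ∃ Z : E → E, IsTangentFieldAt L p Z ∧ Z p = Y then
    (tangentSpace L p)ᗮ.starProjection (covDeriv M p h.choose X)
  else 0

theorem secondFundamentalForm_eq {d : ℕ} {L M : Set E} (hL : IsSmoothSubmanifold d L)
    (hLM : L ⊆ M) {p : E} (hp : p ∈ L) {X : E} (hX : X ∈ tangentSpace L p) {Z : E → E}
    (hZ : IsTangentFieldAt L p Z) :
    secondFundamentalForm L M p X (Z p) =
      (tangentSpace L p)ᗮ.starProjection (covDeriv M p Z X) := by
  have h : ∃ Z' : E → E, IsTangentFieldAt L p Z' ∧ Z' p = Z p := ⟨Z, hZ, rfl⟩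
  rw [secondFundamentalForm, dif_pos h]
  obtain ⟨hc, hcp⟩ := h.choose_spec
  generalize h.choose = Z' at hc hcp
  obtain ⟨U, hU, hpU, hZs, hZt⟩ := hZ
  obtain ⟨U', hU', hpU', hZs', hZt'⟩ := hc
  have hW : IsTangentFieldAt L p (fun x => Z' x - Z x) :=
    ⟨U ∩ U', hU.inter hU', ⟨hpU, hpU'⟩,
      (hZs'.mono inter_subset_right).sub (hZs.mono inter_subset_left),
      fun x hx => Submodule.sub_mem _ (hZt' x ⟨hx.1, hx.2.2⟩) (hZt x ⟨hx.1, hx.2.1⟩)⟩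
  have h1 := fderiv_mem_tangentSpace hL hp hW (by simp [hcp]) hX
  have hd : DifferentiableAt ℝ Z p :=
    (hZs.contDiffAt (hU.mem_nhds hpU)).differentiableAt (by simp)
  have hd' : DifferentiableAt ℝ Z' p :=
    (hZs'.contDiffAt (hU'.mem_nhds hpU')).differentiableAt (by simp)
  rw [fderiv_fun_sub hd' hd, sub_apply] at h1
  have hsub : tangentSpace L p ≤ tangentSpace M p := by
    refine Submodule.span_mono ?_
    rintro w ⟨ε, γ, hε, hγ, hγS, h⟩
    exact ⟨ε, γ, hε, hγ, hγS.mono_right hLM, h⟩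
  rw [← sub_eq_zero, ← map_sub, covDeriv, covDeriv, ← map_sub,
    Submodule.starProjection_apply_eq_zero_iff, Submodule.orthogonal_orthogonal,
    Submodule.starProjection_eq_self_iff.2 (hsub h1)]
  exact h1

/-- The mean curvature vector `H(p) = (1/d) ∑ II_p(e_i, e_i)` of `L` in `M`, where `e_1, …, e_d` is
an orthonormal basis of `T_p L`. -/
def meanCurvature (L M : Set E) (p : E) : E :=
  (1 / (Module.finrank ℝ (tangentSpace L p) : ℝ)) •
    ∑ i, secondFundamentalForm L M p (stdOrthonormalBasis ℝ (tangentSpace L p) i : E)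
      (stdOrthonormalBasis ℝ (tangentSpace L p) i : E)

/-- `L` is a minimal submanifold of `M`. -/
def IsMinimal (L M : Set E) : Prop :=
  ∀ p ∈ L, meanCurvature L M p = 0

/-- The curve `γ`, defined on the open interval `I`, is a geodesic of the submanifold `S` with its
induced metric: it is smooth, lies in `S`, and its covariant acceleration, which is the tangential
part of `γ''`, vanishes. -/
def IsGeodesicOn (S : Set E) (γ : ℝ → E) (I : Set ℝ) : Prop :=
  ContDiffOn ℝ ∞ γ I ∧ MapsTo γ I S ∧
    ∀ t ∈ I, (tangentSpace S (γ t)).starProjection (deriv (deriv γ) t) = 0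

/-- `L` is a totally geodesic submanifold of `M`: every geodesic of `L` is a geodesic of `M`. -/
def IsTotallyGeodesic (L M : Set E) : Prop :=
  ∀ (γ : ℝ → E) (I : Set ℝ), IsOpen I → I.OrdConnected → IsGeodesicOn L γ I → IsGeodesicOn M γ I


end EuclideanSubmanifold

end

namespace EuclideanSubmanifold

variable {E : Type*} [NormedAddCommGroup E] [InnerProductSpace ℝ E]

/-! Transversality and the shadow condition give `T_p M = T_p L ⊕ ℝ v` along `L`. A geodesic of `L`
has its acceleration in the direction of `P` and normal to `L`. It is therefore normal to `M` as
soon as `v` is orthogonal to `P`, and this orthogonality is the crux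
(`starProjection_direction_eq_zero`).

Suppose the projection `u` of `v` to the direction of `P` is nonzero. At a point where `u` is not
tangent to `L`, minimality forces the trace `A` of the second derivatives of `L` to be tangent to
`L`. A maximum of the height `⟪·, u⟫` on the compact `L` gives only a weak inequality, which is no
contradiction. Adding `(ε / 2) ‖x‖ ^ 2` makes the second order condition strict, and for small `ε`
some maximum still has `u` not tangent (`exists_perturbedHeight_max`). -/

theorem tangentSpace_mono {L M : Set E} (h : L ⊆ M) (p : E) :
    tangentSpace L p ≤ tangentSpace M p := by
  refine Submodule.span_mono ?_
  rintro w ⟨ε, γ, hε, hγ, hγS, h'⟩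
  exact ⟨ε, γ, hε, hγ, hγS.mono_right h, h'⟩

/-- The velocity of a smooth curve in `S` is tangent to `S`. -/
theorem deriv_mem_tangentSpace {S : Set E} {γ : ℝ → E} {I : Set ℝ} (hI : IsOpen I)
    (hγ : ContDiffOn ℝ ∞ γ I) (hγS : MapsTo γ I S) {t : ℝ} (ht : t ∈ I) :
    deriv γ t ∈ tangentSpace S (γ t) := by
  refine Submodule.subset_span ?_
  obtain ⟨ε, hε, hball⟩ := Metric.isOpen_iff.1 hI t ht
  rw [Real.ball_eq_Ioo] at hball
  have hmaps : MapsTo (fun s => t + s) (Ioo (-ε) ε) I := fun s hs =>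
    hball ⟨by linarith [hs.1], by linarith [hs.2]⟩
  refine ⟨ε, fun s => γ (t + s), hε, hγ.comp (by fun_prop) hmaps, hγS.comp hmaps, by simp, ?_⟩
  rw [deriv_comp_const_add, add_zero]

/-- A submodule containing `T` with at most one more dimension is generated by `T` and any of its
vectors outside `T`. -/
theorem eq_sup_span_singleton_of_finrank_le [FiniteDimensional ℝ E] {T W : Submodule ℝ E} {x : E}
    (hTW : T ≤ W) (hxW : x ∈ W) (hxT : x ∉ T)
    (h : Module.finrank ℝ W ≤ Module.finrank ℝ T + 1) : T ⊔ Submodule.span ℝ {x} = W := by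
  have hx : x ∈ T ⊔ Submodule.span ℝ {x} :=
    Submodule.mem_sup_right (Submodule.mem_span_singleton_self x)
  refine Submodule.eq_of_le_of_finrank_le
    (sup_le hTW ((Submodule.span_singleton_le_iff_mem _ _).2 hxW)) (h.trans ?_)
  exact Submodule.finrank_lt_finrank_of_lt (lt_of_le_of_ne le_sup_left fun e => hxT (e ▸ hx))

theorem mem_orthogonal_sup_span_singleton {T : Submodule ℝ E} {x y : E} (hT : y ∈ Tᗮ)
    (hx : inner ℝ x y = 0) : y ∈ (T ⊔ Submodule.span ℝ {x})ᗮ := by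
  rw [← Submodule.inf_orthogonal]
  exact ⟨hT, Submodule.mem_orthogonal_singleton_iff_inner_right.2 hx⟩

theorem deriv_differentiableAt {γ : ℝ → E} {I : Set ℝ} (hI : IsOpen I)
    (hγ : ContDiffOn ℝ ∞ γ I) {t : ℝ} (ht : t ∈ I) : DifferentiableAt ℝ (deriv γ) t :=
  ((hγ.deriv_of_isOpen (m := ∞) hI (by simp)).contDiffAt (hI.mem_nhds ht)).differentiableAt
    (by simp)

/-- The function `x ↦ ⟪x, u⟫ + (ε / 2) ‖x‖ ^ 2`. -/
noncomputable def perturbedHeight (u : E) (ε : ℝ) (x : E) : ℝ := inner ℝ x u + ε / 2 * inner ℝ x x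

/-- The gradient of the perturbed height at `x` is `u + ε • x`. -/
theorem hasDerivAt_perturbedHeight {γ : ℝ → E} {w : E} {t : ℝ} (hγ : HasDerivAt γ w t) (u : E)
    (ε : ℝ) : HasDerivAt (fun s => perturbedHeight u ε (γ s)) (inner ℝ w (u + ε • γ t)) t := by
  have h1 := (hγ.inner ℝ (hasDerivAt_const t u)).add ((hγ.inner ℝ hγ).const_mul (ε / 2))
  refine h1.congr_deriv ?_
  rw [inner_zero_right, real_inner_comm (γ t) w, inner_add_right, inner_smul_right,
    real_inner_comm w (γ t)]
  ring

/-! ### Tangent spaces and derivatives along curves -/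

variable [FiniteDimensional ℝ E]

/-- The differential of a slice chart has a left inverse, so it is an automorphism of `E`, and the
tangent space is the preimage of `V` under it. -/
theorem finrank_tangentSpace {d : ℕ} {S : Set E} (hS : IsSmoothSubmanifold d S) {p : E}
    (hp : p ∈ S) : Module.finrank ℝ (tangentSpace S p) = d := by
  obtain ⟨V, Φ, hV, hΦ, hpΦ⟩ := hS p hp
  have hd : DifferentiableAt ℝ Φ p :=
    (hΦ.smooth.contDiffAt (Φ.open_source.mem_nhds hpΦ)).differentiableAt (by simp)
  have hds : DifferentiableAt ℝ Φ.symm (Φ p) :=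
    (hΦ.smooth_symm.contDiffAt (Φ.open_target.mem_nhds (Φ.map_source hpΦ))).differentiableAt
      (by simp)
  have h2 : HasFDerivAt (fun y => Φ.symm (Φ y)) _ p := hds.hasFDerivAt.comp p hd.hasFDerivAt
  have e2 : (fun y => Φ.symm (Φ y)) =ᶠ[𝓝 p] id := by
    filter_upwards [Φ.open_source.mem_nhds hpΦ] with y hy using Φ.left_inv hy
  have h4 := h2.unique ((hasFDerivAt_id p).congr_of_eventuallyEq e2)
  have hinj : Function.Injective (fderiv ℝ Φ p : E →ₗ[ℝ] E) :=
    Function.LeftInverse.injective (g := fderiv ℝ Φ.symm (Φ p)) fun u => by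
      simpa using DFunLike.congr_fun h4 u
  have hT : tangentSpace S p =
      V.comap (LinearEquiv.ofInjectiveEndo (fderiv ℝ Φ p : E →ₗ[ℝ] E) hinj : E →ₗ[ℝ] E) := by
    ext w
    rw [mem_tangentSpace_iff hΦ hp hpΦ]
    rfl
  rw [hT, Submodule.comap_equiv_eq_map_symm, LinearEquiv.finrank_map_eq, hV]

/-- A differentiable vector field along a curve in `S` that is tangent to `S` and vanishes at time
`t` has a tangent derivative at time `t`. -/
theorem hasDerivAt_mem_tangentSpace {d : ℕ} {S : Set E} (hS : IsSmoothSubmanifold d S)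
    {γ W : ℝ → E} {w : E} {t : ℝ} (hγ : DifferentiableAt ℝ γ t) (hγS : ∀ᶠ s in 𝓝 t, γ s ∈ S)
    (hW : HasDerivAt W w t) (hWS : ∀ᶠ s in 𝓝 t, W s ∈ tangentSpace S (γ s)) (hW0 : W t = 0) :
    w ∈ tangentSpace S (γ t) := by
  have hp := hγS.self_of_nhds
  obtain ⟨V, Φ, -, hΦ, hpΦ⟩ := hS _ hp
  have hΦd : DifferentiableAt ℝ (fderiv ℝ Φ) (γ t) :=
    ((hΦ.smooth.fderiv_of_isOpen (m := ∞) Φ.open_source (by simp)).contDiffAt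
      (Φ.open_source.mem_nhds hpΦ)).differentiableAt (by simp)
  have h2 : HasDerivAt (fun s => fderiv ℝ Φ (γ s)) (fderiv ℝ (fderiv ℝ Φ) (γ t) (deriv γ t)) t :=
    hΦd.hasFDerivAt.comp_hasDerivAt t hγ.hasDerivAt
  -- In the product rule the second derivative of the chart is applied to `W t = 0`, so only `fderiv
  -- ℝ Φ (γ t) w` remains.
  have h3 := h2.clm_apply hW
  rw [hW0, map_zero, zero_add] at h3
  rw [mem_tangentSpace_iff hΦ hp hpΦ]
  refine mem_of_hasDerivAt_of_eventually_mem V h3 ?_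
  filter_upwards [hγS, hWS, hγ.continuousAt (Φ.open_source.mem_nhds hpΦ)] with s h1 h2 h3
  exact (mem_tangentSpace_iff hΦ h1 h3).1 h2

/-- A fixed vector that is not tangent to `S` at `p` is not tangent to `S` near `p`. -/
theorem eventually_notMem_tangentSpace {d : ℕ} {S : Set E} (hS : IsSmoothSubmanifold d S) {p : E}
    (hp : p ∈ S) {u : E} (hu : u ∉ tangentSpace S p) :
    ∀ᶠ q in 𝓝[S] p, u ∉ tangentSpace S q := by
  obtain ⟨V, Φ, -, hΦ, hpΦ⟩ := hS p hp
  have hc : ContinuousAt (fun q => fderiv ℝ Φ q u) p :=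
    (((hΦ.smooth.fderiv_of_isOpen (m := ∞) Φ.open_source (by simp)).contDiffAt
      (Φ.open_source.mem_nhds hpΦ)).continuousAt).clm_apply continuousAt_const
  have hV : (V : Set E)ᶜ ∈ 𝓝 (fderiv ℝ Φ p u) :=
    V.closed_of_finiteDimensional.isOpen_compl.mem_nhds fun h =>
      hu ((mem_tangentSpace_iff hΦ hp hpΦ).2 h)
  filter_upwards [self_mem_nhdsWithin, mem_nhdsWithin_of_mem_nhds (hc hV),
    mem_nhdsWithin_of_mem_nhds (Φ.open_source.mem_nhds hpΦ)] with q hq h1 h2 h3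
  exact h1 ((mem_tangentSpace_iff hΦ hq h2).1 h3)

/-- The tangent spaces of a subset of an affine subspace lie in its direction. -/
theorem tangentSpace_le_direction {S : Set E} {P : AffineSubspace ℝ E} (h : S ⊆ (P : Set E))
    (p : E) : tangentSpace S p ≤ P.direction := by
  refine Submodule.span_le.2 ?_
  rintro w ⟨ε, γ, hε, hγ, hγS, rfl, rfl⟩
  have h0 : Ioo (-ε) ε ∈ 𝓝 (0 : ℝ) := Ioo_mem_nhds (by linarith) hε
  have hd : HasDerivAt (fun s => γ s - γ 0) (deriv γ 0) 0 :=
    ((hγ.contDiffAt h0).differentiableAt (by simp)).hasDerivAt.sub_const _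
  refine mem_of_hasDerivAt_of_eventually_mem _ hd ?_
  filter_upwards [h0] with s hs
  exact AffineSubspace.vsub_mem_direction (h (hγS hs)) (h (hγS (mem_of_mem_nhds h0)))

/-- The acceleration of a curve in an affine subspace lies in its direction. -/
theorem deriv_deriv_mem_direction {P : AffineSubspace ℝ E} {γ : ℝ → E} {I : Set ℝ} (hI : IsOpen I)
    (hγ : ContDiffOn ℝ ∞ γ I) (hγP : MapsTo γ I P) {t : ℝ} (ht : t ∈ I) :
    deriv (deriv γ) t ∈ P.direction := by
  refine mem_of_hasDerivAt_of_eventually_mem _ (deriv_differentiableAt hI hγ ht).hasDerivAt ?_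
  filter_upwards [hI.mem_nhds ht] with s hs
  exact tangentSpace_le_direction subset_rfl _ (deriv_mem_tangentSpace hI hγ hγP hs)

theorem fderiv_mem_direction {S : Set E} {P : AffineSubspace ℝ E} (h : S ⊆ (P : Set E)) {p : E}
    {Z : E → E} (hZ : IsTangentFieldAt S p Z) {X : E} (hX : X ∈ velocities S p) :
    fderiv ℝ Z p X ∈ P.direction := by
  obtain ⟨U, hU, hpU, hZs, hZt⟩ := hZ
  obtain ⟨ε, γ, hε, hγ, hγS, rfl, rfl⟩ := hX
  have h0 : Ioo (-ε) ε ∈ 𝓝 (0 : ℝ) := Ioo_mem_nhds (by linarith) hε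
  have hγ0 : DifferentiableAt ℝ γ 0 := (hγ.contDiffAt h0).differentiableAt (by simp)
  have hZd : DifferentiableAt ℝ Z (γ 0) :=
    (hZs.contDiffAt (hU.mem_nhds hpU)).differentiableAt (by simp)
  refine mem_of_hasDerivAt_of_eventually_mem _
    (hZd.hasFDerivAt.comp_hasDerivAt (0 : ℝ) hγ0.hasDerivAt) ?_
  filter_upwards [h0, hγ0.continuousAt (hU.mem_nhds hpU)] with s hs hs'
  exact tangentSpace_le_direction h _ (hZt _ ⟨hγS hs, hs'⟩)

/-- The acceleration of a curve in `S` agrees with the derivative of any tangent vector field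
extending its velocity, up to a tangent vector. -/
theorem deriv_deriv_sub_fderiv_mem_tangentSpace {d : ℕ} {S : Set E}
    (hS : IsSmoothSubmanifold d S) {γ : ℝ → E} {I : Set ℝ} (hI : IsOpen I)
    (hγ : ContDiffOn ℝ ∞ γ I) (hγS : MapsTo γ I S) {t : ℝ} (ht : t ∈ I) {Z : E → E}
    (hZ : IsTangentFieldAt S (γ t) Z) (hZt : Z (γ t) = deriv γ t) :
    deriv (deriv γ) t - fderiv ℝ Z (γ t) (deriv γ t) ∈ tangentSpace S (γ t) := by
  obtain ⟨U, hU, hpU, hZs, hZU⟩ := hZ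
  have hI' := hI.mem_nhds ht
  have hγ0 : DifferentiableAt ℝ γ t := (hγ.contDiffAt hI').differentiableAt (by simp)
  have hZd : DifferentiableAt ℝ Z (γ t) :=
    (hZs.contDiffAt (hU.mem_nhds hpU)).differentiableAt (by simp)
  refine hasDerivAt_mem_tangentSpace hS hγ0 (Filter.mem_of_superset hI' hγS)
    ((deriv_differentiableAt hI hγ ht).hasDerivAt.sub
      (hZd.hasFDerivAt.comp_hasDerivAt t hγ0.hasDerivAt)) ?_ (by simp [hZt])
  filter_upwards [hI', hγ0.continuousAt (hU.mem_nhds hpU)] with s hs hs'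
  exact Submodule.sub_mem _ (deriv_mem_tangentSpace hI hγ hγS hs) (hZU _ ⟨hγS hs, hs'⟩)

/-! ### Maxima of perturbed height functions -/

/-- The necessary second order condition at a local maximum. -/
theorem second_deriv_nonpos_of_isLocalMax {g g' : ℝ → ℝ} {c t : ℝ}
    (hg : ∀ᶠ s in 𝓝 t, HasDerivAt g (g' s) s) (hg' : HasDerivAt g' c t) (hmax : IsLocalMax g t) :
    c ≤ 0 := by
  by_contra! hc
  have he : deriv g =ᶠ[𝓝 t] g' := hg.mono fun s hs => hs.deriv
  have h2 : deriv (deriv g) t = c := by rw [he.deriv_eq, hg'.deriv]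
  -- If `c > 0`, then `t` is also a local minimum, so `g` is locally constant and `c = 0`.
  have hmin := isLocalMin_of_deriv_deriv_pos (h2.symm ▸ hc) hmax.deriv_eq_zero
    hg.self_of_nhds.continuousAt
  have hconst : g =ᶠ[𝓝 t] fun _ => g t := by
    filter_upwards [hmin, hmax] with s h1 h2 using le_antisymm h2 h1
  have h3 := hconst.deriv.deriv_eq
  simp only [deriv_const', deriv_const] at h3
  linarith

/-- The first order condition at a maximum of `perturbedHeight` on a submanifold. -/
theorem inner_eq_zero_of_perturbedHeight_max {d : ℕ} {S : Set E} (hS : IsSmoothSubmanifold d S)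
    {u q : E} {ε : ℝ}
    (hq : q ∈ S) (hmax : ∀ x ∈ S, perturbedHeight u ε x ≤ perturbedHeight u ε q)
    {X : E} (hX : X ∈ tangentSpace S q) : inner ℝ X (u + ε • q) = 0 := by
  rw [← SetLike.mem_coe, coe_tangentSpace hS hq] at hX
  obtain ⟨δ, γ, hδ, hγ, hγS, rfl, rfl⟩ := hX
  have h0 : Ioo (-δ) δ ∈ 𝓝 (0 : ℝ) := Ioo_mem_nhds (by linarith) hδ
  have hγ0 : DifferentiableAt ℝ γ 0 := (hγ.contDiffAt h0).differentiableAt (by simp)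
  have hloc : IsLocalMax (fun s => perturbedHeight u ε (γ s)) 0 := by
    filter_upwards [h0] with s hs using hmax _ (hγS hs)
  exact hloc.hasDerivAt_eq_zero (hasDerivAt_perturbedHeight hγ0.hasDerivAt u ε)

/-- The second order condition at a maximum of `perturbedHeight` on a submanifold. -/
theorem fderiv_inner_add_le_zero_of_perturbedHeight_max {d : ℕ} {S : Set E}
    (hS : IsSmoothSubmanifold d S) {u q : E}
    {ε : ℝ} (hq : q ∈ S) (hmax : ∀ x ∈ S, perturbedHeight u ε x ≤ perturbedHeight u ε q)
    {Z : E → E} (hZ : IsTangentFieldAt S q Z) :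
    inner ℝ (fderiv ℝ Z q (Z q)) (u + ε • q) + ε * inner ℝ (Z q) (Z q) ≤ 0 := by
  have hX : Z q ∈ tangentSpace S q := by
    obtain ⟨U, -, hqU, -, hZU⟩ := hZ
    exact hZU q ⟨hq, hqU⟩
  rw [← SetLike.mem_coe, coe_tangentSpace hS hq] at hX
  obtain ⟨δ, γ, hδ, hγ, hγS, rfl, hγZ⟩ := hX
  have h0' : (0 : ℝ) ∈ Ioo (-δ) δ := ⟨by linarith, hδ⟩
  have h0 : Ioo (-δ) δ ∈ 𝓝 (0 : ℝ) := isOpen_Ioo.mem_nhds h0'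
  have hd : ∀ s ∈ Ioo (-δ) δ, HasDerivAt γ (deriv γ s) s := fun s hs =>
    ((hγ.contDiffAt (isOpen_Ioo.mem_nhds hs)).differentiableAt (by simp)).hasDerivAt
  have hdd := (deriv_differentiableAt isOpen_Ioo hγ h0').hasDerivAt
  have hloc : IsLocalMax (fun s => perturbedHeight u ε (γ s)) 0 := by
    filter_upwards [h0] with s hs using hmax _ (hγS hs)
  have hg : ∀ᶠ s in 𝓝 (0 : ℝ), HasDerivAt (fun s => perturbedHeight u ε (γ s))
      (inner ℝ (deriv γ s) (u + ε • γ s)) s := by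
    filter_upwards [h0] with s hs using hasDerivAt_perturbedHeight (hd s hs) u ε
  have h2 := second_deriv_nonpos_of_isLocalMax hg
    (hdd.inner ℝ (((hd 0 h0').const_smul ε).const_add u)) hloc
  -- The acceleration and the derivative of `Z` differ by a tangent vector, which is orthogonal to
  -- the gradient at a maximum.
  have h3 := inner_eq_zero_of_perturbedHeight_max hS hq hmax
    (deriv_deriv_sub_fderiv_mem_tangentSpace hS isOpen_Ioo hγ hγS h0' hZ hγZ.symm)
  rw [inner_sub_left] at h3
  rw [hγZ, inner_smul_right] at h2
  rw [hγZ] at h3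
  linarith

/-- Near a maximum of the height function `⟪·, u⟫` on a compact submanifold, there is a maximum of a
perturbed height function at which `u` is not tangent. -/
theorem exists_perturbedHeight_max {d : ℕ} {L : Set E} (hL : IsSmoothSubmanifold d L)
    (hLc : IsCompact L) (hne : L.Nonempty) {u : E} (hu : u ≠ 0) :
    ∃ ε > 0, ∃ q ∈ L, (∀ x ∈ L, perturbedHeight u ε x ≤ perturbedHeight u ε q) ∧
      u ∉ tangentSpace L q := by
  have hcont : Continuous fun y : ℝ × E => perturbedHeight u y.1 y.2 := by
    unfold perturbedHeight
    fun_prop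
  have hex : ∀ m : ℕ, ∃ q ∈ L, ∀ x ∈ L,
      perturbedHeight u (1 / ((m : ℝ) + 1)) x ≤ perturbedHeight u (1 / ((m : ℝ) + 1)) q := fun m =>
    hLc.exists_isMaxOn hne
      (hcont.comp (Continuous.prodMk continuous_const continuous_id)).continuousOn
  choose q hqL hqmax using hex
  obtain ⟨p, hp, φ, hφ, hlim⟩ := hLc.tendsto_subseq hqL
  have hε : Filter.Tendsto (fun m => 1 / ((φ m : ℝ) + 1)) Filter.atTop (𝓝 0) :=
    (tendsto_one_div_add_atTop_nhds_zero_nat (𝕜 := ℝ)).comp hφ.tendsto_atTop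
  have hpmax : ∀ x ∈ L, perturbedHeight u 0 x ≤ perturbedHeight u 0 p := by
    intro x hx
    refine le_of_tendsto_of_tendsto' ((hcont.tendsto (0, x)).comp (hε.prodMk_nhds
      tendsto_const_nhds)) ((hcont.tendsto (0, p)).comp (hε.prodMk_nhds hlim)) fun m => ?_
    exact hqmax (φ m) x hx
  -- The limit `p` maximizes the plain height, so `u` is normal to `L` there; were it also tangent,
  -- `⟪u, u⟫` would vanish. Non-tangency then passes to nearby maxima.
  have hup : u ∉ tangentSpace L p := fun h => by
    have := inner_eq_zero_of_perturbedHeight_max hL hp hpmax h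
    simp [hu] at this
  have hev := (tendsto_nhdsWithin_iff.2 ⟨hlim, Filter.Eventually.of_forall fun m =>
    hqL (φ m)⟩).eventually (eventually_notMem_tangentSpace hL hp hup)
  obtain ⟨m, hm⟩ := hev.exists
  exact ⟨1 / ((φ m : ℝ) + 1), by positivity, q (φ m), hqL _, hqmax _, hm⟩

/-- A compact minimal hypersurface of positive dimension of `M`, lying in the shadow boundary of `M`
with respect to `v` and in an affine hyperplane transverse to `v`, forces `v` to be orthogonal to
that hyperplane. -/
theorem starProjection_direction_eq_zero {k : ℕ} (hk : k ≠ 0) {M L : Set E} {v : E}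
    (hL : IsSmoothSubmanifold k L) (hLc : IsCompact L) (hne : L.Nonempty) (hLM : L ⊆ M)
    (hLS : L ⊆ shadowBoundary M (fun _ => v)) {P : AffineSubspace ℝ E}
    (hP : Module.finrank ℝ P.direction = k + 1) (hLP : L ⊆ (P : Set E)) (hmin : IsMinimal L M) :
    P.direction.starProjection v = 0 := by
  by_contra hu
  set u := P.direction.starProjection v with hu_def
  obtain ⟨ε, hε, q, hq, hmax, huq⟩ := exists_perturbedHeight_max hL hLc hne hu
  have hTP := tangentSpace_le_direction hLP q
  have hfr := finrank_tangentSpace hL hq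
  have hspan := eq_sup_span_singleton_of_finrank_le hTP
    (P.direction.starProjection_apply_mem v) huq (by rw [hP, hfr])
  have hmem := fun i => (stdOrthonormalBasis ℝ (tangentSpace L q) i).2
  choose Z hZ hZe using fun i => exists_isTangentFieldAt hL hq (hmem i)
  set A := ∑ i, fderiv ℝ (Z i) q (Z i q) with hA_def
  have hAP : A ∈ P.direction := Submodule.sum_mem _ fun i _ => by
    refine fderiv_mem_direction hLP (hZ i) ?_
    rw [← coe_tangentSpace hL hq, hZe]
    exact hmem i
  have hsum := hmin q hq
  -- The factor `1 / k` can be cancelled because `k ≠ 0`.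
  rw [meanCurvature, smul_eq_zero_iff_right (by rw [hfr]; positivity)] at hsum
  have hII : ∀ i, secondFundamentalForm L M q
      (stdOrthonormalBasis ℝ (tangentSpace L q) i : E)
      (stdOrthonormalBasis ℝ (tangentSpace L q) i : E) = (tangentSpace L q)ᗮ.starProjection
        ((tangentSpace M q).starProjection (fderiv ℝ (Z i) q (Z i q))) := by
    intro i
    have h := secondFundamentalForm_eq hL hLM hq (hmem i) (hZ i)
    rw [hZe i] at h ⊢
    exact h
  simp only [hII] at hsum
  -- Minimality now says that the part of `A` tangent to `M` is tangent to `L`.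
  rw [← map_sum, ← map_sum, ← hA_def, Submodule.starProjection_apply_eq_zero_iff,
    Submodule.orthogonal_orthogonal] at hsum
  set a := (tangentSpace M q).starProjection A with ha_def
  have hb : A - a ∈ (tangentSpace M q)ᗮ := Submodule.sub_starProjection_mem_orthogonal A
  have hbP : A - a ∈ P.direction := P.direction.sub_mem hAP (hTP hsum)
  -- Since `A - a` lies in the direction of `P`, pairing it with `u` is pairing it with `v`, which
  -- is tangent to `M`.
  have hbu : inner ℝ u (A - a) = 0 := by
    rw [hu_def, Submodule.inner_starProjection_left_eq_right,
      Submodule.starProjection_eq_self_iff.2 hbP]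
    exact hb v (hLS hq).2
  -- `A - a` is orthogonal to `T_q L` and to `u`, which together span the direction of `P`
  -- containing it.
  have hb0 : A - a = 0 := by
    have h := mem_orthogonal_sup_span_singleton
      (Submodule.orthogonal_le (tangentSpace_mono hLM q) hb) hbu
    rw [hspan] at h
    exact inner_self_eq_zero.1 (h _ hbP)
  have hA : A ∈ tangentSpace L q := by rw [sub_eq_zero.1 hb0]; exact hsum
  -- The first order condition removes `A` from the sum of the second order conditions over the
  -- frame, leaving `ε * k ≤ 0`.
  have h1 := inner_eq_zero_of_perturbedHeight_max hL hq hmax hA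
  have h2 : ∑ i, (inner ℝ (fderiv ℝ (Z i) q (Z i q)) (u + ε • q) +
      ε * inner ℝ (Z i q) (Z i q)) ≤ 0 :=
    Finset.sum_nonpos fun i _ => fderiv_inner_add_le_zero_of_perturbedHeight_max hL hq hmax (hZ i)
  have h3 : ∀ i, (inner ℝ (Z i q) (Z i q) : ℝ) = 1 := fun i => by
    rw [hZe, ← Submodule.coe_inner, real_inner_self_eq_norm_sq, OrthonormalBasis.norm_eq_one,
      one_pow]
  simp only [h3] at h2
  rw [Finset.sum_add_distrib, ← sum_inner, ← hA_def, h1, Finset.sum_const, Finset.card_univ,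
    Fintype.card_fin, hfr, nsmul_eq_mul] at h2
  have : (0 : ℝ) < k := by positivity
  nlinarith

end EuclideanSubmanifold

open EuclideanSubmanifold
theorem mainTheorem10 (n k : ℕ) (hcodim : k + 1 = n)
    (M L : Set (EuclideanSpace ℝ (Fin (n + 1)))) (v : EuclideanSpace ℝ (Fin (n + 1)))
    (hM : EuclideanSubmanifold.IsSmoothSubmanifold n M)
    (hv : v ≠ 0)
    (hL : EuclideanSubmanifold.IsSmoothSubmanifold k L)
    (hLc : IsCompact L)
    (hLS : L ⊆ EuclideanSubmanifold.shadowBoundary M (fun _ => v))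
    (P : AffineSubspace ℝ (EuclideanSpace ℝ (Fin (n + 1))))
    (hP : Module.finrank ℝ P.direction = n)
    (hPv : v ∉ P.direction)
    (hLP : L ⊆ (P : Set (EuclideanSpace ℝ (Fin (n + 1)))))
    (hmin : EuclideanSubmanifold.IsMinimal L M) :
    EuclideanSubmanifold.IsTotallyGeodesic L M := by
  have hLM : L ⊆ M := fun x hx => (hLS hx).1
  rintro γ I hI - ⟨hγ, hγL, hgeo⟩
  refine ⟨hγ, hγL.mono_right hLM, fun t ht => ?_⟩
  rw [Submodule.starProjection_apply_eq_zero_iff]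
  have hfr := fun s (hs : s ∈ I) => finrank_tangentSpace hL (hγL hs)
  -- For `k = 0` minimality carries no information, but curves in `L` have zero velocity.
  rcases eq_or_ne k 0 with rfl | hk
  · have hγ' : deriv γ =ᶠ[𝓝 t] fun _ => 0 := by
      filter_upwards [hI.mem_nhds ht] with s hs
      have h := deriv_mem_tangentSpace hI hγ hγL hs
      rwa [Submodule.finrank_eq_zero.1 (hfr s hs), Submodule.mem_bot] at h
    rw [hγ'.deriv_eq, deriv_const]
    exact Submodule.zero_mem _
  · have hu := starProjection_direction_eq_zero hk hL hLc ⟨_, hγL ht⟩ hLM hLS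
      (hP.trans hcodim.symm) hLP hmin
    rw [Submodule.starProjection_apply_eq_zero_iff] at hu
    -- By dimension, `T M = T L ⊕ ℝ v` at `γ t`: `v` is tangent to `M` but, being transverse to `P`,
    -- not to `L`.
    rw [← eq_sup_span_singleton_of_finrank_le (tangentSpace_mono hLM _) (hLS (hγL ht)).2
      (fun h => hPv (tangentSpace_le_direction hLP _ h))
      (by rw [finrank_tangentSpace hM (hLM (hγL ht)), hfr t ht, hcodim])]
    refine mem_orthogonal_sup_span_singleton
      ((Submodule.starProjection_apply_eq_zero_iff _).1 (hgeo t ht)) ?_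
    exact Submodule.inner_left_of_mem_orthogonal
      (deriv_deriv_mem_direction hI hγ (hγL.mono_right hLP) ht) hu
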